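/- Let $n,p$ be positive integers, $\sigma>0$, $\mu\in\mathbf R^n$, and let $X$ be any real (deterministic) $n\times p$ matrix. Observe $y=\mu+\xi$, where the random vector $\xi$ satisfies $\mathbb E\exp(v^T\xi)\le\exp(\sigma^2|v|_2^2/2)$ for all $v\in\mathbf R^n$. Write $\|u\|^2=\frac1n|u|_2^2$ for $u\in\mathbf R^n$, $\mathrm{supp}(\beta)=\{k:\beta_k\neq0\}$ and $\|\beta\|_0=|\mathrm{supp}(\beta)|$ for $\beta\in\mathbf R^p$. For every $\lambda\ge0$ let $\hat\beta^L_\lambda$ be any minimizer over $\beta\in\mathbf R^p$ of $\frac1{2n}|y-X\beta|_2^2+\lambda\sum_{j=1}^p|\beta_j|$. Let $$\hat F=\{\mathrm{supp}(\hat\beta^L_\lambda):\lambda\ge0\}$$ be the (finite) family of all supports that appear on the Lasso path. For $T\subset\{1,\dots,p\}$ let $\Pi_T$ be the orthogonal projection of $\mathbf R^n$ onto the span of the columns of $X$ with index in $T$, and let $\pi_T=\big(H_p\binom p{|T|}e^{|T|}\big)^{-1}$ with $H_p=\frac{e-e^{-p}}{e-1}$. Let $\hat\sigma^2$ be any real-valued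 estimator and $\delta=\mathbb P(\hat\sigma^2<\sigma^2)$. Let $\hat\mu^Q=\hat\mu_{\hat\theta}$, where $\hat\mu_\theta=\sum_{T\in\hat F}\theta_T\Pi_Ty$ and $\hat\theta$ is any minimizer, over the simplex $\{\theta\in\mathbf R^{\hat F}:\theta_T\ge0,\ \sum_{T\in\hat F}\theta_T=1\}$, of $$H(\theta)=|\hat\mu_\theta-y|_2^2+\frac12\sum_{T\in\hat F}\theta_T|\Pi_Ty-\hat\mu_\theta|_2^2+26\,\hat\sigma^2\sum_{T\in\hat F}\theta_T\log\frac1{\pi_T}.$$ Then for every $x>0$ there is an event of probability greater than $1-\delta-2e^{-x}$ on which $$\|\hat\mu^Q-\mu\|^2\le\inf_{\lambda>0}\left(\|X\hat\beta^L_\lambda-\mu\|^2+\frac{\hat\sigma^2}n\Big(24+96\,\|\hat\beta^L_\lambda\|_0\log\frac{ep}{\|\hat\beta^L_\lambda\|_0\vee1}\Big)\right)+\frac{22\sigma^2x}n.$$ -/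

import Mathlib

namespace LassoAgg

noncomputable section

variable {n p : ℕ}

/-- The vector `X β`, in `ℝⁿ` with its Euclidean norm. -/
def predict (X : Matrix (Fin n) (Fin p) ℝ) (b : Fin p → ℝ) : EuclideanSpace ℝ (Fin n) :=
  WithLp.toLp 2 (X.mulVec b)

/-- The empirical loss `‖u‖² = (1/n) |u|₂²`. -/
def empSq (u : EuclideanSpace ℝ (Fin n)) : ℝ := (1 / (n : ℝ)) * ‖u‖ ^ 2

/-- The Lasso objective `(1/(2n)) |y - X β|₂² + lam |β|₁`. -/
def lassoObj (X : Matrix (Fin n) (Fin p) ℝ) (y : EuclideanSpace ℝ (Fin n)) (lam : ℝ)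
    (b : Fin p → ℝ) : ℝ :=
  1 / (2 * (n : ℝ)) * ‖y - predict X b‖ ^ 2 + lam * ∑ j, |b j|

/-- `b` is a Lasso estimate with tuning parameter `lam`: any minimizer of the objective
(for `lam = 0` this is any least squares solution). -/
def IsLasso (X : Matrix (Fin n) (Fin p) ℝ) (y : EuclideanSpace ℝ (Fin n)) (lam : ℝ)
    (b : Fin p → ℝ) : Prop :=
  IsMinOn (lassoObj X y lam) Set.univ b

/-- The support of a coefficient vector; its cardinality is the `ℓ⁰` norm. -/
def supp (b : Fin p → ℝ) : Finset (Fin p) := Finset.univ.filter fun j => b j ≠ 0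

open Classical in
/-- The (finite) family of all supports that appear on the path `lam ↦ b lam`, `lam ≥ 0`. -/
def pathSupports (b : ℝ → Fin p → ℝ) : Finset (Finset (Fin p)) :=
  Finset.univ.filter fun T => ∃ lam : ℝ, 0 ≤ lam ∧ supp (b lam) = T

/-- The linear span of the columns of `X` with index in `T`. -/
def colSpan (X : Matrix (Fin n) (Fin p) ℝ) (T : Finset (Fin p)) :
    Submodule ℝ (EuclideanSpace ℝ (Fin n)) :=
  Submodule.span ℝ ((fun j => (WithLp.toLp 2 (X.col j) : EuclideanSpace ℝ (Fin n))) '' (T : Set (Fin p)))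

/-- The least squares estimator `Π_T y`, with `Π_T` the orthogonal projection onto
`colSpan X T`. -/
def lsq (X : Matrix (Fin n) (Fin p) ℝ) (T : Finset (Fin p)) (y : EuclideanSpace ℝ (Fin n)) :
    EuclideanSpace ℝ (Fin n) :=
  (colSpan X T).starProjection y

/-- The normalizing constant `H_p = (e - e^{-p}) / (e - 1)`. -/
def weightConst (p : ℕ) : ℝ :=
  (Real.exp 1 - Real.exp (-(p : ℝ))) / (Real.exp 1 - 1)

/-- The weight `π_T = (H_p * binom(p, |T|) * e^{|T|})⁻¹`. -/
def weight (T : Finset (Fin p)) : ℝ :=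
  (weightConst p * (p.choose T.card : ℝ) * Real.exp (T.card : ℝ))⁻¹

/-- `μ_θ = ∑_{T ∈ F} θ_T Π_T y`. -/
def aggregate (X : Matrix (Fin n) (Fin p) ℝ) (y : EuclideanSpace ℝ (Fin n))
    (F : Finset (Finset (Fin p))) (θ : F → ℝ) : EuclideanSpace ℝ (Fin n) :=
  ∑ T : F, θ T • lsq X T y

/-- The criterion
`H(θ) = |μ_θ - y|² + (1/2) ∑ θ_T |Π_T y - μ_θ|² + 26 s2 ∑ θ_T log (1/π_T)`. -/
def aggCrit (X : Matrix (Fin n) (Fin p) ℝ) (y : EuclideanSpace ℝ (Fin n))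
    (F : Finset (Finset (Fin p))) (s2 : ℝ) (θ : F → ℝ) : ℝ :=
  ‖aggregate X y F θ - y‖ ^ 2
    + 1 / 2 * ∑ T : F, θ T * ‖lsq X T y - aggregate X y F θ‖ ^ 2
    + 26 * s2 * ∑ T : F, θ T * Real.log (1 / weight (T : Finset (Fin p)))

/-- `m` is the `Q`-aggregation estimator for the family `F` and the variance estimate `s2`:
`m = μ_θ` for some minimizer `θ` of the criterion over the simplex. -/
def IsQAggregate (X : Matrix (Fin n) (Fin p) ℝ) (y : EuclideanSpace ℝ (Fin n))
    (F : Finset (Finset (Fin p))) (s2 : ℝ) (m : EuclideanSpace ℝ (Fin n)) : Prop :=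
  ∃ θ ∈ stdSimplex ℝ F, IsMinOn (aggCrit X y F s2) (stdSimplex ℝ F) θ ∧ m = aggregate X y F θ

/-- The random vector `ξ` is subgaussian with noise level `σ`:
`E exp(vᵀ ξ) ≤ exp(σ² |v|² / 2)` for all `v` (in particular the expectation is finite). -/
def IsSubgaussianVec {Ω : Type*} [MeasurableSpace Ω] (P : MeasureTheory.Measure Ω) (σ : ℝ)
    (ξ : Ω → EuclideanSpace ℝ (Fin n)) : Prop :=
  ∀ v : EuclideanSpace ℝ (Fin n),
    MeasureTheory.Integrable (fun ω => Real.exp (inner ℝ v (ξ ω))) P ∧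
      ∫ ω, Real.exp (inner ℝ v (ξ ω)) ∂P ≤ Real.exp (σ ^ 2 * ‖v‖ ^ 2 / 2)

end

end LassoAgg

namespace LassoAgg

open MeasureTheory Module
open scoped RealInnerProductSpace ENNReal

/-! ### Curvature and optimality in Q-aggregation. -/

section QAggregation

variable {ι E : Type*} [Fintype ι] [NormedAddCommGroup E] [InnerProductSpace ℝ E]

/-! On the simplex the criterion is half a squared norm plus a linear function of `θ`, so optimality
towards a vertex `j` yields the extra gain `1/2 * ∑ θ_k ‖f k - f j‖ ^ 2`
(`q_aggregation_optimality`). This gain absorbs the noise term `2 ⟪ξ, m - Xβ⟫`, since each `f k -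
Xβ` lies in the span of the columns indexed by the union of two supports.

The family of supports depends on the data, so the noise is controlled on the spans of all pairs of
subsets at once. The weights sum to one, and `log (1 / weight T)` dominates `|T|`, hence the
dimensions: the union bound over pairs costs only logarithms of weights
(`measureReal_iUnion_pairs_le`). Lasso optimality plays no role: `Xβ` only has to lie in the span of
its support, and Pythagoras compares it with the projection of `y`. -/

theorem sum_mul_norm_sub_sq (f : ι → E) (θ : ι → ℝ) (hθ : ∑ k, θ k = 1) (v : E) :
    ∑ k, θ k * ‖f k - v‖ ^ 2 =
      ∑ k, θ k * ‖f k‖ ^ 2 - 2 * ⟪∑ k, θ k • f k, v⟫ + ‖v‖ ^ 2 := by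
  simp_rw [norm_sub_sq_real, mul_add, mul_sub, Finset.sum_add_distrib, Finset.sum_sub_distrib,
    ← Finset.sum_mul, hθ, sum_inner, real_inner_smul_left, Finset.mul_sum]
  simp only [one_mul, add_left_inj, sub_right_inj]
  exact Finset.sum_congr rfl fun k _ => by ring

theorem sum_mul_linear_part (f : ι → E) (y : E) (K θ : ι → ℝ) :
    ∑ k, θ k * (1 / 2 * ‖f k‖ ^ 2 - 2 * ⟪f k, y⟫ + K k) =
      1 / 2 * ∑ k, θ k * ‖f k‖ ^ 2 - 2 * ⟪∑ k, θ k • f k, y⟫ + ∑ k, θ k * K k := by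
  simp_rw [sum_inner, real_inner_smul_left, Finset.mul_sum, ← Finset.sum_sub_distrib,
    ← Finset.sum_add_distrib]
  exact Finset.sum_congr rfl fun k _ => by ring

/-- The dispersion penalty cancels half of the curvature of the fit term; what remains is convex. -/
theorem penalized_crit_eq (f : ι → E) (y : E) (K θ : ι → ℝ) (hθ : ∑ k, θ k = 1) :
    ‖∑ k, θ k • f k - y‖ ^ 2 + 1 / 2 * ∑ k, θ k * ‖f k - ∑ k, θ k • f k‖ ^ 2 + ∑ k, θ k * K k =
      1 / 2 * ‖∑ k, θ k • f k‖ ^ 2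
        + ∑ k, θ k * (1 / 2 * ‖f k‖ ^ 2 - 2 * ⟪f k, y⟫ + K k) + ‖y‖ ^ 2 := by
  rw [sum_mul_norm_sub_sq f θ hθ, real_inner_self_eq_norm_sq, norm_sub_sq_real,
    sum_mul_linear_part]
  ring

theorem nonneg_of_forall_mul_add_sq_nonneg {a c : ℝ}
    (h : ∀ t : ℝ, 0 < t → t ≤ 1 → 0 ≤ t * a + t ^ 2 * c) : 0 ≤ a := by
  by_contra! ha
  have hc := abs_nonneg c
  have h1 : 0 < |c| - a + 1 := by linarith
  -- This `t` lies in `(0, 1]` and satisfies `t * |c| < -a`, so the linear term wins.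
  have h2 := h (-a / (|c| - a + 1)) (div_pos (by linarith) h1) ((div_le_one h1).2 (by linarith))
  have h3 : -a / (|c| - a + 1) * a + (-a / (|c| - a + 1)) ^ 2 * c =
      (-a / (|c| - a + 1) ^ 2) * (a * (|c| - a + 1 - c)) := by
    field_simp
    ring
  have h4 : a * (|c| - a + 1 - c) < 0 :=
    mul_neg_of_neg_of_pos ha (by linarith [le_abs_self c])
  have h5 : 0 < -a / (|c| - a + 1) ^ 2 := div_pos (by linarith) (by positivity)
  linarith [mul_neg_of_pos_of_neg h5 h4]

/-- First order optimality of a minimizer of the `Q`-aggregation criterion, in the direction of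
a vertex of the simplex. -/
theorem q_aggregation_optimality (f : ι → E) (y : E) (K θ : ι → ℝ)
    (hθ : θ ∈ stdSimplex ℝ ι)
    (hmin : ∀ η ∈ stdSimplex ℝ ι,
      ‖∑ k, θ k • f k - y‖ ^ 2 + 1 / 2 * ∑ k, θ k * ‖f k - ∑ k, θ k • f k‖ ^ 2
          + ∑ k, θ k * K k ≤
        ‖∑ k, η k • f k - y‖ ^ 2 + 1 / 2 * ∑ k, η k * ‖f k - ∑ k, η k • f k‖ ^ 2
          + ∑ k, η k * K k) (j : ι) :
    ‖∑ k, θ k • f k - y‖ ^ 2 + ∑ k, θ k * K k + 1 / 2 * ∑ k, θ k * ‖f k - f j‖ ^ 2 ≤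
      ‖f j - y‖ ^ 2 + K j := by
  classical
  have hsum := sum_mul_linear_part f y K θ
  set G : ι → ℝ := fun k => 1 / 2 * ‖f k‖ ^ 2 - 2 * ⟪f k, y⟫ + K k with hG
  set a := ∑ k, θ k • f k with ha
  -- Directional derivative at `θ` towards vertex `j`; the criterion is exactly quadratic along this
  -- segment.
  have key : 0 ≤ (⟪a, f j⟫ + G j) - (‖a‖ ^ 2 + ∑ k, θ k * G k) := by
    refine nonneg_of_forall_mul_add_sq_nonneg
      (c := 1 / 2 * ‖a‖ ^ 2 - ⟪a, f j⟫ + 1 / 2 * ‖f j‖ ^ 2) fun t ht ht1 => ?_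
    set η : ι → ℝ := (1 - t) • θ + t • Pi.single j 1 with hη
    have hηs : η ∈ stdSimplex ℝ ι :=
      convex_stdSimplex ℝ ι hθ (single_mem_stdSimplex ℝ j) (by linarith) ht.le (by ring)
    have h := hmin η hηs
    rw [penalized_crit_eq f y K θ hθ.2, penalized_crit_eq f y K η hηs.2] at h
    have h1 : ∑ k, η k • f k = (1 - t) • a + t • f j := by
      simp [hη, add_smul, Finset.sum_add_distrib, mul_smul, ← Finset.smul_sum, ha, Pi.single_apply]
    have h2 : ∑ k, η k * G k = (1 - t) * ∑ k, θ k * G k + t * G j := by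
      simp [hη, add_mul, Finset.sum_add_distrib, mul_assoc, ← Finset.mul_sum, Pi.single_apply]
    have h3 : ‖(1 - t) • a + t • f j‖ ^ 2 =
        (1 - t) ^ 2 * ‖a‖ ^ 2 + 2 * (t * (1 - t)) * ⟪a, f j⟫ + t ^ 2 * ‖f j‖ ^ 2 := by
      rw [norm_add_sq_real, norm_smul, norm_smul, real_inner_smul_left, real_inner_smul_right,
        mul_pow, mul_pow, Real.norm_eq_abs, Real.norm_eq_abs, sq_abs, sq_abs]
      ring
    change 1 / 2 * ‖a‖ ^ 2 + ∑ k, θ k * G k + ‖y‖ ^ 2 ≤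
      1 / 2 * ‖∑ k, η k • f k‖ ^ 2 + ∑ k, η k * G k + ‖y‖ ^ 2 at h
    rw [h1, h2, h3] at h
    linarith
  rw [sum_mul_norm_sub_sq f θ hθ.2, ← ha, norm_sub_sq_real, norm_sub_sq_real]
  rw [hsum] at key
  simp only [hG] at key
  linarith

end QAggregation

/-! ### Tails of projected subgaussian noise. -/

section GaussianTail

variable {V : Type*} [NormedAddCommGroup V] [InnerProductSpace ℝ V] [FiniteDimensional ℝ V]
  [MeasurableSpace V] [BorelSpace V]

theorem lintegral_exp_neg_mul_sq_norm_add {c : ℝ} (hc : 0 < c) (w : V) :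
    ∫⁻ v : V, ENNReal.ofReal (Real.exp (-c * ‖v‖ ^ 2 + ⟪w, v⟫)) =
      ENNReal.ofReal ((Real.pi / c) ^ (finrank ℝ V / 2 : ℝ) * Real.exp (‖w‖ ^ 2 / (4 * c))) := by
  have hsplit : ∀ v : V, (Complex.exp (-(c : ℂ) * ‖v‖ ^ 2 + 1 * (⟪w, v⟫ : ℝ))) =
      ((Real.exp (-c * ‖v‖ ^ 2 + ⟪w, v⟫) : ℝ) : ℂ) := fun v => by push_cast; ring_nf
  have hint := GaussianFourier.integrable_cexp_neg_mul_sq_norm_add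
    (show 0 < (c : ℂ).re from hc) 1 w
  have hval := GaussianFourier.integral_cexp_neg_mul_sq_norm_add
    (show 0 < (c : ℂ).re from hc) 1 w
  simp_rw [hsplit] at hint hval
  have hint' : Integrable fun v : V => Real.exp (-c * ‖v‖ ^ 2 + ⟪w, v⟫) := by
    simpa only [RCLike.re_to_complex, Complex.ofReal_re] using hint.re
  rw [integral_complex_ofReal] at hval
  have hval' : ∫ v : V, Real.exp (-c * ‖v‖ ^ 2 + ⟪w, v⟫) =
      (Real.pi / c) ^ (finrank ℝ V / 2 : ℝ) * Real.exp (‖w‖ ^ 2 / (4 * c)) := by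
    rw [← Complex.ofReal_inj, hval]
    push_cast
    rw [Complex.ofReal_cpow (by positivity)]
    push_cast
    simp
  rw [← hval', ofReal_integral_eq_lintegral_ofReal hint' (ae_of_all _ fun v => (Real.exp_pos _).le)]

end GaussianTail

/-- The exponential of a square is a Gaussian integral of exponentials of linear forms. Tonelli lets
the subgaussian bound act under that integral, turning the factor `σ ^ 2` in the Gaussian into `σ ^
2 / 2`; the ratio of the normalizing constants is `2 ^ (dim / 2)`. -/
theorem lintegral_exp_sq_norm_starProjection_le {n : ℕ} {Ω : Type*} [MeasurableSpace Ω]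
    (P : Measure Ω) [IsProbabilityMeasure P] {σ : ℝ} (hσ : 0 < σ)
    {ξ : Ω → EuclideanSpace ℝ (Fin n)} (hξ : Measurable ξ) (hsub : IsSubgaussianVec P σ ξ)
    (W : Submodule ℝ (EuclideanSpace ℝ (Fin n))) :
    ∫⁻ ω, ENNReal.ofReal (Real.exp (‖W.starProjection (ξ ω)‖ ^ 2 / (4 * σ ^ 2))) ∂P ≤
      ENNReal.ofReal (2 ^ (finrank ℝ W / 2 : ℝ)) := by
  have hσ2 : 0 < σ ^ 2 := by positivity
  have hC : 0 < (Real.pi / σ ^ 2) ^ (finrank ℝ W / 2 : ℝ) := by positivity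
  have hproj : ∀ (ω : Ω) (v : W),
      ⟪W.orthogonalProjectionOnto (ξ ω), v⟫ = ⟪(v : EuclideanSpace ℝ (Fin n)), ξ ω⟫ := by
    intro ω v
    rw [real_inner_comm, Submodule.inner_orthogonalProjectionOnto_eq_of_mem_left]
  have hnorm : ∀ ω, ‖W.starProjection (ξ ω)‖ = ‖W.orthogonalProjectionOnto (ξ ω)‖ := fun ω => rfl
  have hmeas : Measurable fun z : Ω × W =>
      ENNReal.ofReal (Real.exp (-σ ^ 2 * ‖z.2‖ ^ 2 + ⟪W.orthogonalProjectionOnto (ξ z.1), z.2⟫)) := by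
    fun_prop
  have hswap : ∫⁻ ω, ∫⁻ v : W, ENNReal.ofReal
        (Real.exp (-σ ^ 2 * ‖v‖ ^ 2 + ⟪W.orthogonalProjectionOnto (ξ ω), v⟫)) ∂volume ∂P =
      ∫⁻ v : W, ∫⁻ ω, ENNReal.ofReal
        (Real.exp (-σ ^ 2 * ‖v‖ ^ 2 + ⟪W.orthogonalProjectionOnto (ξ ω), v⟫)) ∂P ∂volume :=
    lintegral_lintegral_swap hmeas.aemeasurable
  have hinner : ∀ v : W, ∫⁻ ω, ENNReal.ofReal
        (Real.exp (-σ ^ 2 * ‖v‖ ^ 2 + ⟪W.orthogonalProjectionOnto (ξ ω), v⟫)) ∂P ≤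
      ENNReal.ofReal (Real.exp (-(σ ^ 2 / 2) * ‖v‖ ^ 2 + ⟪(0 : W), v⟫)) := by
    intro v
    obtain ⟨hi, hle⟩ := hsub v
    simp_rw [Real.exp_add, hproj, ENNReal.ofReal_mul (Real.exp_pos _).le]
    rw [lintegral_const_mul' _ _ ENNReal.ofReal_ne_top,
      ← ofReal_integral_eq_lintegral_ofReal hi (ae_of_all _ fun _ => (Real.exp_pos _).le),
      ← ENNReal.ofReal_mul (Real.exp_pos _).le, ← ENNReal.ofReal_mul (Real.exp_pos _).le]
    refine ENNReal.ofReal_le_ofReal ?_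
    refine (mul_le_mul_of_nonneg_left hle (Real.exp_pos _).le).trans (le_of_eq ?_)
    rw [← Real.exp_add, ← Real.exp_add, inner_zero_left, Submodule.coe_norm]
    ring_nf
  have hmono := lintegral_mono (μ := (volume : Measure W)) hinner
  rw [← hswap, lintegral_exp_neg_mul_sq_norm_add (half_pos hσ2)] at hmono
  simp_rw [lintegral_exp_neg_mul_sq_norm_add hσ2, ENNReal.ofReal_mul hC.le] at hmono
  rw [lintegral_const_mul' _ _ ENNReal.ofReal_ne_top] at hmono
  have hr : ENNReal.ofReal ((Real.pi / (σ ^ 2 / 2)) ^ (finrank ℝ W / 2 : ℝ)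
        * Real.exp (‖(0 : W)‖ ^ 2 / (4 * (σ ^ 2 / 2)))) =
      ENNReal.ofReal ((Real.pi / σ ^ 2) ^ (finrank ℝ W / 2 : ℝ)) *
        ENNReal.ofReal (2 ^ (finrank ℝ W / 2 : ℝ)) := by
    rw [← ENNReal.ofReal_mul hC.le, ← Real.mul_rpow (by positivity) (by norm_num)]
    congr 1
    simp only [norm_zero]
    norm_num
    congr 1
    field_simp
  simp_rw [hnorm]
  rw [← ENNReal.mul_le_mul_iff_right (a := ENNReal.ofReal ((Real.pi / σ ^ 2) ^ (finrank ℝ W / 2 : ℝ)))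
    (by simpa using hC) ENNReal.ofReal_ne_top]
  exact hmono.trans hr.le

theorem measure_sq_norm_starProjection_gt_le {n : ℕ} {Ω : Type*} [MeasurableSpace Ω]
    (P : Measure Ω) [IsProbabilityMeasure P] {σ : ℝ} (hσ : 0 < σ)
    {ξ : Ω → EuclideanSpace ℝ (Fin n)} (hξ : Measurable ξ) (hsub : IsSubgaussianVec P σ ξ)
    (W : Submodule ℝ (EuclideanSpace ℝ (Fin n))) (t : ℝ) :
    P {ω | 4 * σ ^ 2 * (t + finrank ℝ W / 2) < ‖W.starProjection (ξ ω)‖ ^ 2} ≤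
      ENNReal.ofReal (Real.exp (-t)) := by
  set d : ℝ := finrank ℝ W / 2 with hd
  have hmeas : Measurable fun ω =>
      ENNReal.ofReal (Real.exp (‖W.starProjection (ξ ω)‖ ^ 2 / (4 * σ ^ 2))) := by fun_prop
  have h := (mul_meas_ge_le_lintegral₀ (μ := P) hmeas.aemeasurable
    (ENNReal.ofReal (Real.exp (t + d)))).trans
    (lintegral_exp_sq_norm_starProjection_le P hσ hξ hsub W)
  -- Since `2 ≤ e`, the shift by `d` in Markov's threshold pays for the dimensional factor.
  have h2 : (2 : ℝ) ^ d ≤ Real.exp d := by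
    rw [← Real.exp_one_rpow]
    exact Real.rpow_le_rpow (by norm_num) Real.exp_one_gt_two.le (by positivity)
  have h3 : ENNReal.ofReal (2 ^ d) ≤
      ENNReal.ofReal (Real.exp (t + d)) * ENNReal.ofReal (Real.exp (-t)) := by
    rw [← ENNReal.ofReal_mul (Real.exp_pos _).le, ← Real.exp_add]
    exact ENNReal.ofReal_le_ofReal (by simpa using h2)
  have h4 := (ENNReal.mul_le_mul_iff_right (by simpa using Real.exp_pos _)
    ENNReal.ofReal_ne_top).1 (h.trans h3)
  refine (measure_mono fun ω hω => ?_).trans h4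
  refine ENNReal.ofReal_le_ofReal (Real.exp_le_exp.2 ?_)
  rw [le_div_iff₀ (by positivity)]
  have : 4 * σ ^ 2 * (t + d) < ‖W.starProjection (ξ ω)‖ ^ 2 := hω
  linarith

/-! ### Weights on supports. -/

theorem one_le_weightConst (p : ℕ) : 1 ≤ weightConst p := by
  have h1 := Real.exp_one_gt_two
  have h2 : Real.exp (-(p : ℝ)) ≤ 1 := Real.exp_le_one_iff.2 (by simp)
  rw [weightConst, le_div_iff₀ (by linarith)]
  linarith

theorem log_weightConst_le (p : ℕ) : Real.log (weightConst p) ≤ 1 / 2 := by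
  have h1 := Real.exp_one_gt_d9
  have h2 := Real.exp_pos (-(p : ℝ))
  have h3 := Real.quadratic_le_exp_of_nonneg (x := 1 / 2) (by norm_num)
  -- `e / (e - 1) < 1.6 < 1 + 1/2 + 1/8 ≤ exp (1/2)`.
  have h4 : weightConst p ≤ 1.6 := by
    rw [weightConst, div_le_iff₀ (by linarith)]
    linarith
  rw [Real.log_le_iff_le_exp (by linarith [one_le_weightConst p])]
  linarith

variable {n p : ℕ}

theorem choose_card_pos (T : Finset (Fin p)) : 0 < (p.choose T.card : ℝ) := by
  have := Nat.choose_pos (card_finset_fin_le T)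
  exact_mod_cast this

theorem weight_pos (T : Finset (Fin p)) : 0 < weight T := by
  have h1 := one_le_weightConst p
  have h2 := choose_card_pos T
  have h3 := Real.exp_pos (T.card : ℝ)
  rw [weight]
  positivity

/-- Grouping by cardinality cancels the binomials and leaves a geometric sum of ratio `1 / e`, equal
to `weightConst p`. -/
theorem sum_weight (p : ℕ) : ∑ T : Finset (Fin p), weight T = 1 := by
  have h1 := one_le_weightConst p
  have he := Real.exp_one_gt_two
  have hsum : ∑ T : Finset (Fin p), weight T =
      ∑ k ∈ Finset.range (p + 1), (weightConst p)⁻¹ * (Real.exp (-1)) ^ k := by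
    have h := Finset.sum_powerset_apply_card
      (fun k => (weightConst p * (p.choose k : ℝ) * Real.exp (k : ℝ))⁻¹)
      (x := (Finset.univ : Finset (Fin p)))
    rw [Finset.powerset_univ, Finset.card_univ, Fintype.card_fin] at h
    refine h.trans (Finset.sum_congr rfl fun k hk => ?_)
    have hc : (p.choose k : ℝ) ≠ 0 := by
      have := Nat.choose_pos (Finset.mem_range_succ_iff.1 hk)
      positivity
    rw [nsmul_eq_mul, ← Real.exp_nat_mul, mul_neg_one, Real.exp_neg]
    field_simp
  rw [hsum, ← Finset.mul_sum, geom_sum_eq (by rw [Ne, Real.exp_eq_one_iff]; norm_num),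
    ← Real.exp_nat_mul, weightConst]
  have h2 : Real.exp (((p + 1 : ℕ) : ℝ) * -1) = Real.exp (-(p : ℝ)) * (Real.exp 1)⁻¹ := by
    rw [← Real.exp_neg, ← Real.exp_add]
    push_cast
    ring_nf
  have h3 : Real.exp (-(p : ℝ)) ≤ 1 := Real.exp_le_one_iff.2 (by simp)
  have h4 : Real.exp 1 - Real.exp (-(p : ℝ)) ≠ 0 := by linarith
  have h5 : Real.exp 1 - 1 ≠ 0 := by linarith
  have h6 : 1 - Real.exp 1 ≠ 0 := by linarith
  rw [h2, Real.exp_neg 1]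
  field_simp
  ring

theorem log_one_div_weight (T : Finset (Fin p)) :
    Real.log (1 / weight T) =
      Real.log (weightConst p) + Real.log (p.choose T.card : ℝ) + T.card := by
  have h1 := one_le_weightConst p
  have h2 := choose_card_pos T
  rw [weight, one_div, inv_inv, Real.log_mul (by positivity) (by positivity),
    Real.log_mul (by positivity) h2.ne', Real.log_exp]

theorem card_le_log_one_div_weight (T : Finset (Fin p)) :
    (T.card : ℝ) ≤ Real.log (1 / weight T) := by
  have h2 : (1 : ℝ) ≤ p.choose T.card := by exact_mod_cast choose_card_pos T
  rw [log_one_div_weight]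
  linarith [Real.log_nonneg (one_le_weightConst p), Real.log_nonneg h2]

/-- Combines `choose ≤ p ^ t / t!` with `t ^ t / t! ≤ e ^ t`. -/
theorem log_choose_le {t : ℕ} (ht : 0 < t) (htp : t ≤ p) :
    Real.log (p.choose t : ℝ) ≤ t * Real.log (Real.exp 1 * p / t) := by
  have hp : (0 : ℝ) < p := by exact_mod_cast ht.trans_le htp
  have ht' : (0 : ℝ) < t := by exact_mod_cast ht
  have hc : (0 : ℝ) < p.choose t := by exact_mod_cast Nat.choose_pos htp
  have h1 : (p.choose t : ℝ) ≤ (p : ℝ) ^ t / (t.factorial : ℝ) := Nat.choose_le_pow_div t p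
  have h2 := Real.pow_div_factorial_le_exp (t : ℝ) ht'.le t
  have h3 : (p.choose t : ℝ) ≤ (Real.exp 1 * p / t) ^ t := by
    refine h1.trans ?_
    rw [div_pow, mul_pow, ← Real.exp_nat_mul, mul_one]
    have hf : (0 : ℝ) < t.factorial := by positivity
    rw [div_le_iff₀ hf] at h2
    rw [div_le_div_iff₀ hf (by positivity)]
    nlinarith [mul_le_mul_of_nonneg_left h2 (pow_pos hp t).le]
  rw [← Real.log_pow]
  exact Real.log_le_log hc h3

theorem log_one_div_weight_le (T : Finset (Fin p)) :
    Real.log (1 / weight T) ≤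
      1 / 2 + 2 * ((T.card : ℝ) * Real.log (Real.exp 1 * p / max (T.card : ℝ) 1)) := by
  rw [log_one_div_weight]
  have h0 := log_weightConst_le p
  rcases Nat.eq_zero_or_pos T.card with h | h
  · simp [h]
    linarith
  · have htp := card_finset_fin_le T
    have h1 : (1 : ℝ) ≤ T.card := by exact_mod_cast h
    have h2 : (T.card : ℝ) ≤ p := by exact_mod_cast htp
    have h3 := log_choose_le h htp
    rw [max_eq_left h1]
    have hp : (0 : ℝ) < p := by linarith
    -- Because `|T| ≤ p`, the term `|T|` is absorbed too, whence the factor 2.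
    have h4 : 1 ≤ Real.log (Real.exp 1 * p / T.card) := by
      rw [Real.le_log_iff_exp_le (by positivity), le_div_iff₀ (by positivity)]
      gcongr
    nlinarith

/-! ### Column spans and projections. -/

theorem colSpan_mono (X : Matrix (Fin n) (Fin p) ℝ) {S T : Finset (Fin p)} (h : S ⊆ T) :
    colSpan X S ≤ colSpan X T :=
  Submodule.span_mono (Set.image_mono (by exact_mod_cast h))

theorem finrank_colSpan_le (X : Matrix (Fin n) (Fin p) ℝ) (T : Finset (Fin p)) :
    finrank ℝ (colSpan X T) ≤ T.card := by
  classical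
  rw [colSpan, ← Finset.coe_image]
  exact (finrank_span_finset_le_card _).trans Finset.card_image_le

theorem predict_mem_colSpan (X : Matrix (Fin n) (Fin p) ℝ) (b : Fin p → ℝ) :
    predict X b ∈ colSpan X (supp b) := by
  have h : predict X b = ∑ j, b j • (WithLp.toLp 2 (X.col j) : EuclideanSpace ℝ (Fin n)) := by
    ext i
    simp [predict, Matrix.mulVec, dotProduct, mul_comm]
  rw [h]
  refine Submodule.sum_mem _ fun j _ => ?_
  by_cases hj : b j = 0
  · simp [hj]
  · exact Submodule.smul_mem _ _ (Submodule.subset_span ⟨j, by simp [supp, hj], rfl⟩)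

theorem lsq_mem_colSpan (X : Matrix (Fin n) (Fin p) ℝ) (T : Finset (Fin p))
    (y : EuclideanSpace ℝ (Fin n)) : lsq X T y ∈ colSpan X T :=
  Submodule.starProjection_apply_mem _ _

theorem sq_norm_sub_eq_add_of_mem_colSpan (X : Matrix (Fin n) (Fin p) ℝ) (T : Finset (Fin p))
    (y : EuclideanSpace ℝ (Fin n)) {h : EuclideanSpace ℝ (Fin n)} (hh : h ∈ colSpan X T) :
    ‖h - y‖ ^ 2 = ‖lsq X T y - y‖ ^ 2 + ‖h - lsq X T y‖ ^ 2 := by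
  have h1 : ⟪y - lsq X T y, h - lsq X T y⟫ = 0 :=
    Submodule.starProjection_inner_eq_zero _ _ (Submodule.sub_mem _ hh (lsq_mem_colSpan X T y))
  have h2 : h - y = (lsq X T y - y) + (h - lsq X T y) := by abel
  rw [h2, norm_add_sq_real, ← neg_sub y, inner_neg_left, h1]
  ring

theorem two_mul_inner_le_of_mem {V : Type*} [NormedAddCommGroup V] [InnerProductSpace ℝ V]
    (W : Submodule ℝ V) [W.HasOrthogonalProjection] (z : V) {w : V} (hw : w ∈ W) {c : ℝ}
    (hc : 0 < c) : 2 * ⟪z, w⟫ ≤ c * ‖w‖ ^ 2 + ‖W.starProjection z‖ ^ 2 / c := by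
  have h1 : ⟪z, w⟫ = ⟪W.starProjection z, w⟫ := by
    have := Submodule.starProjection_inner_eq_zero (K := W) z w hw
    rw [inner_sub_left] at this
    linarith
  have h2 := real_inner_le_norm (W.starProjection z) w
  have h3 : c * ‖w‖ ^ 2 + ‖W.starProjection z‖ ^ 2 / c - 2 * (‖W.starProjection z‖ * ‖w‖) =
      (c * ‖w‖ - ‖W.starProjection z‖) ^ 2 / c := by
    field_simp
    ring
  have h4 : 0 ≤ (c * ‖w‖ - ‖W.starProjection z‖) ^ 2 / c := by positivity
  rw [h1]
  linarith

/-! ### Oracle inequality and noise event. -/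

/-- Deterministic oracle inequality for the `Q`-aggregate of least squares estimators, on the
event where the noise is controlled on the span of every pair of supports. -/
theorem sq_norm_aggregate_sub_le (X : Matrix (Fin n) (Fin p) ℝ)
    {μ ξ y m : EuclideanSpace ℝ (Fin n)} (hy : y = μ + ξ) {F : Finset (Finset (Fin p))}
    {σ s2 x : ℝ} (hs2 : σ ^ 2 ≤ s2)
    (hξ : ∀ S T : Finset (Fin p), ‖(colSpan X (S ∪ T)).starProjection ξ‖ ^ 2 ≤
      σ ^ 2 * (4 * x + 6 * Real.log (1 / weight S) + 6 * Real.log (1 / weight T)))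
    (hm : IsQAggregate X y F s2 m) (b : Fin p → ℝ) (hb : supp b ∈ F) :
    ‖m - μ‖ ^ 2 ≤ ‖predict X b - μ‖ ^ 2 + 44 * s2 * Real.log (1 / weight (supp b))
      + 12 * σ ^ 2 * x := by
  obtain ⟨θ, hθ, hmin, hmθ⟩ := hm
  set h := predict X b with hh
  set L : Finset (Fin p) → ℝ := fun T => Real.log (1 / weight T) with hL
  set f : F → EuclideanSpace ℝ (Fin n) := fun T => lsq X T y with hf
  have hL0 : ∀ T, 0 ≤ L T := fun T => (Nat.cast_nonneg _).trans (card_le_log_one_div_weight T)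
  have hcrit : ∀ η : F → ℝ, aggCrit X y F s2 η =
      ‖∑ k, η k • f k - y‖ ^ 2 + 1 / 2 * ∑ k, η k * ‖f k - ∑ k, η k • f k‖ ^ 2
        + ∑ k, η k * (26 * s2 * L k) := by
    intro η
    have : ∑ k, η k * (26 * s2 * L k) = 26 * s2 * ∑ k, η k * L k := by
      rw [Finset.mul_sum]
      exact Finset.sum_congr rfl fun k _ => by ring
    rw [this]
    rfl
  have hopt := q_aggregation_optimality f y (fun k => 26 * s2 * L k) θ hθ
    (fun η hη => by rw [← hcrit, ← hcrit]; exact hmin hη) ⟨supp b, hb⟩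
  have hma : m = ∑ k, θ k • f k := hmθ
  rw [← hma] at hopt
  set fT := f ⟨supp b, hb⟩ with hfT
  have hpyth : ‖h - y‖ ^ 2 = ‖fT - y‖ ^ 2 + ‖h - fT‖ ^ 2 :=
    sq_norm_sub_eq_add_of_mem_colSpan X (supp b) y (predict_mem_colSpan X b)
  have hexp : ∀ u : EuclideanSpace ℝ (Fin n),
      ‖u - y‖ ^ 2 = ‖u - μ‖ ^ 2 - 2 * ⟪ξ, u - μ⟫ + ‖ξ‖ ^ 2 := by
    intro u
    rw [hy, ← sub_sub, norm_sub_sq_real, real_inner_comm]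
  -- Young's inequality with `c = 1/2` and `c = 1` costs `2 + 1 = 3` squared noise norms, hence `12
  -- x` and `18 L`. The penalty `26 s2` covers the `18` at `k`; at the oracle `26 + 18 = 44`.
  have hpair : ∀ k : F, 2 * ⟪ξ, f k - h⟫ ≤ 1 / 2 * ‖f k - fT‖ ^ 2 + ‖h - fT‖ ^ 2
      + 26 * s2 * L k + (12 * σ ^ 2 * x + 18 * s2 * L (supp b)) := by
    intro k
    set W := colSpan X ((k : Finset (Fin p)) ∪ supp b)
    have hkW : f k ∈ W := colSpan_mono X Finset.subset_union_left (lsq_mem_colSpan X k y)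
    have hTW : fT ∈ W := colSpan_mono X Finset.subset_union_right (lsq_mem_colSpan X (supp b) y)
    have hhW : h ∈ W := colSpan_mono X Finset.subset_union_right (predict_mem_colSpan X b)
    have h1 := two_mul_inner_le_of_mem W ξ (W.sub_mem hkW hTW) (c := 1 / 2) (by norm_num)
    have h2 := two_mul_inner_le_of_mem W ξ (W.sub_mem hTW hhW) (c := 1) (by norm_num)
    have h3 := hξ k (supp b)
    have h4 : ⟪ξ, f k - h⟫ = ⟪ξ, f k - fT⟫ + ⟪ξ, fT - h⟫ := by
      rw [← inner_add_right, sub_add_sub_cancel]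
    rw [norm_sub_rev fT h] at h2
    have h5 := mul_le_mul_of_nonneg_right hs2 (hL0 k)
    have h6 := mul_le_mul_of_nonneg_right hs2 (hL0 (supp b))
    have h7 : 0 ≤ s2 * L k := mul_nonneg ((sq_nonneg σ).trans hs2) (hL0 k)
    change ‖W.starProjection ξ‖ ^ 2 ≤ σ ^ 2 * (4 * x + 6 * L k + 6 * L (supp b)) at h3
    rw [h4]
    linarith
  have havg : 2 * ⟪ξ, m - h⟫ ≤ 1 / 2 * ∑ k, θ k * ‖f k - fT‖ ^ 2 + ‖h - fT‖ ^ 2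
      + ∑ k, θ k * (26 * s2 * L k) + (12 * σ ^ 2 * x + 18 * s2 * L (supp b)) := by
    have h1 := Finset.sum_le_sum fun k (_ : k ∈ Finset.univ) =>
      mul_le_mul_of_nonneg_left (hpair k) (hθ.1 k)
    have h2 : ∑ k, θ k * (2 * ⟪ξ, f k - h⟫) = 2 * ⟪ξ, m - h⟫ := by
      rw [hma]
      simp_rw [inner_sub_right, inner_sum, real_inner_smul_right, mul_sub, Finset.sum_sub_distrib,
        ← Finset.sum_mul, hθ.2, Finset.mul_sum]
      rw [one_mul]
      congr 1
      exact Finset.sum_congr rfl fun k _ => by ring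
    rw [h2] at h1
    refine h1.trans (le_of_eq ?_)
    simp_rw [mul_add (θ _), Finset.sum_add_distrib, ← Finset.sum_mul, hθ.2, Finset.mul_sum]
    rw [one_mul, one_mul, one_mul]
    have h8 : ∑ k, θ k * (1 / 2 * ‖f k - fT‖ ^ 2) = ∑ k, 1 / 2 * (θ k * ‖f k - fT‖ ^ 2) :=
      Finset.sum_congr rfl fun k _ => by ring
    rw [h8]
  have hinn : ⟪ξ, m - h⟫ = ⟪ξ, m - μ⟫ - ⟪ξ, h - μ⟫ := by
    rw [← inner_sub_right, sub_sub_sub_cancel_right]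
  have e1 := hexp m
  have e2 := hexp h
  change _ ≤ ‖h - μ‖ ^ 2 + 44 * s2 * L (supp b) + _
  change _ ≤ _ + 26 * s2 * L (supp b) at hopt
  linarith

/-- Union bound over all pairs of supports. -/
theorem measureReal_iUnion_pairs_le {Ω : Type*} [MeasurableSpace Ω] (P : Measure Ω)
    [IsProbabilityMeasure P] {σ : ℝ} (hσ : 0 < σ) {ξ : Ω → EuclideanSpace ℝ (Fin n)}
    (hξ : Measurable ξ) (hsub : IsSubgaussianVec P σ ξ) (X : Matrix (Fin n) (Fin p) ℝ) (x : ℝ) :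
    P.real (⋃ q : Finset (Fin p) × Finset (Fin p),
      {ω | σ ^ 2 * (4 * x + 6 * Real.log (1 / weight q.1) + 6 * Real.log (1 / weight q.2)) <
        ‖(colSpan X (q.1 ∪ q.2)).starProjection (ξ ω)‖ ^ 2}) ≤ Real.exp (-x) := by
  have hone : ∀ S T : Finset (Fin p),
      P.real {ω | σ ^ 2 * (4 * x + 6 * Real.log (1 / weight S) + 6 * Real.log (1 / weight T)) <
        ‖(colSpan X (S ∪ T)).starProjection (ξ ω)‖ ^ 2} ≤
      Real.exp (-x) * (weight S * weight T) := by
    intro S T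
    have h1 := measure_sq_norm_starProjection_gt_le P hσ hξ hsub (colSpan X (S ∪ T))
      (x + Real.log (1 / weight S) + Real.log (1 / weight T))
    have h2 : Real.exp (-(x + Real.log (1 / weight S) + Real.log (1 / weight T))) =
        Real.exp (-x) * (weight S * weight T) := by
      rw [one_div, one_div, Real.log_inv, Real.log_inv, neg_add, neg_add, neg_neg, neg_neg,
        Real.exp_add, Real.exp_add, Real.exp_log (weight_pos S), Real.exp_log (weight_pos T),
        mul_assoc]
    rw [h2] at h1
    have h3 : (finrank ℝ (colSpan X (S ∪ T)) : ℝ) ≤ S.card + T.card := by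
      exact_mod_cast (finrank_colSpan_le X _).trans (Finset.card_union_le S T)
    have h4 := card_le_log_one_div_weight S
    have h5 := card_le_log_one_div_weight T
    -- The dimension enters with factor `4 / 2 = 2` and is at most the sum of the two logarithms, so
    -- `4 + 2 = 6`.
    have h6 : 4 * σ ^ 2 * (x + Real.log (1 / weight S) + Real.log (1 / weight T)
          + finrank ℝ (colSpan X (S ∪ T)) / 2) ≤
        σ ^ 2 * (4 * x + 6 * Real.log (1 / weight S) + 6 * Real.log (1 / weight T)) := by
      rw [mul_comm 4, mul_assoc]
      exact mul_le_mul_of_nonneg_left (by linarith) (sq_nonneg σ)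
    exact ENNReal.toReal_le_of_le_ofReal
      (mul_nonneg (Real.exp_pos _).le (mul_pos (weight_pos S) (weight_pos T)).le)
      ((measure_mono fun ω hω => lt_of_le_of_lt h6 hω).trans h1)
  refine (measureReal_iUnion_fintype_le _).trans
    ((Finset.sum_le_sum fun q _ => hone q.1 q.2).trans (le_of_eq ?_))
  rw [← Finset.mul_sum, Fintype.sum_prod_type]
  simp_rw [← Finset.mul_sum]
  rw [sum_weight]
  simp only [mul_one]
  rw [sum_weight, mul_one]

end LassoAgg

theorem mainTheorem3 {n p : ℕ} (hn : 0 < n) (hp : 0 < p) (σ : ℝ) (hσ : 0 < σ)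
    {Ω : Type*} [MeasurableSpace Ω] (P : MeasureTheory.Measure Ω)
    [MeasureTheory.IsProbabilityMeasure P]
    (μ : EuclideanSpace ℝ (Fin n)) (X : Matrix (Fin n) (Fin p) ℝ)
    (ξ y : Ω → EuclideanSpace ℝ (Fin n)) (hξ : Measurable ξ)
    (hsub : LassoAgg.IsSubgaussianVec P σ ξ)
    (hy : ∀ ω, y ω = μ + ξ ω)
    (s2 : Ω → ℝ) (hs2 : Measurable s2)
    (δ : ℝ) (hδ : δ = P.real {ω | s2 ω < σ ^ 2})
    (b : Ω → ℝ → Fin p → ℝ)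
    (hb : ∀ ω, ∀ lam : ℝ, 0 ≤ lam → LassoAgg.IsLasso X (y ω) lam (b ω lam))
    (m : Ω → EuclideanSpace ℝ (Fin n))
    (hm : ∀ ω, LassoAgg.IsQAggregate X (y ω) (LassoAgg.pathSupports (b ω)) (s2 ω) (m ω))
    (x : ℝ) (hx : 0 < x) :
    ∃ A : Set Ω, MeasurableSet A ∧ 1 - δ - 2 * Real.exp (-x) < P.real A ∧
      ∀ ω ∈ A, ∀ lam : ℝ, 0 < lam →
        LassoAgg.empSq (m ω - μ) ≤
          LassoAgg.empSq (LassoAgg.predict X (b ω lam) - μ)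
          + s2 ω / n * (24 + 96 * ((LassoAgg.supp (b ω lam)).card : ℝ) *
              Real.log (Real.exp 1 * p / max ((LassoAgg.supp (b ω lam)).card : ℝ) 1))
          + 22 * σ ^ 2 * x / n := by

  set B : Set Ω := ⋃ q : Finset (Fin p) × Finset (Fin p),
    {ω | σ ^ 2 * (4 * x + 6 * Real.log (1 / LassoAgg.weight q.1)
        + 6 * Real.log (1 / LassoAgg.weight q.2)) <
      ‖(LassoAgg.colSpan X (q.1 ∪ q.2)).starProjection (ξ ω)‖ ^ 2} with hB
  set C : Set Ω := {ω | s2 ω < σ ^ 2} with hC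
  have hBm : MeasurableSet B :=
    MeasurableSet.iUnion fun q => measurableSet_lt measurable_const (by fun_prop)
  have hCm : MeasurableSet C := measurableSet_lt hs2 measurable_const
  have hPB : P.real B ≤ Real.exp (-x) :=
    LassoAgg.measureReal_iUnion_pairs_le P hσ hξ hsub X x
  refine ⟨(C ∪ B)ᶜ, (hCm.union hBm).compl, ?_, fun ω hω lam hlam => ?_⟩
  · rw [MeasureTheory.probReal_compl_eq_one_sub (hCm.union hBm), hδ]
    have h1 := MeasureTheory.measureReal_union_le (μ := P) C B
    have h2 := Real.exp_pos (-x)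
    linarith
  · have hωC : σ ^ 2 ≤ s2 ω := not_lt.1 fun h => hω (Or.inl h)
    have hωB : ∀ S T : Finset (Fin p),
        ‖(LassoAgg.colSpan X (S ∪ T)).starProjection (ξ ω)‖ ^ 2 ≤
          σ ^ 2 * (4 * x + 6 * Real.log (1 / LassoAgg.weight S)
            + 6 * Real.log (1 / LassoAgg.weight T)) := fun S T =>
      not_lt.1 fun h => hω (Or.inr (Set.mem_iUnion.2 ⟨(S, T), h⟩))
    have hmem : LassoAgg.supp (b ω lam) ∈ LassoAgg.pathSupports (b ω) := by
      simp only [LassoAgg.pathSupports, Finset.mem_filter, Finset.mem_univ, true_and]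
      exact ⟨lam, hlam.le, rfl⟩
    have hmain := LassoAgg.sq_norm_aggregate_sub_le X (hy ω) hωC hωB (hm ω) (b ω lam) hmem
    have hw := LassoAgg.log_one_div_weight_le (LassoAgg.supp (b ω lam))
    have hcard := (Nat.cast_nonneg _).trans
      (LassoAgg.card_le_log_one_div_weight (LassoAgg.supp (b ω lam)))
    set t : ℝ := ((LassoAgg.supp (b ω lam)).card : ℝ)
    set l := Real.log (Real.exp 1 * p / max t 1)
    set L := Real.log (1 / LassoAgg.weight (LassoAgg.supp (b ω lam)))
    have hs0 : 0 ≤ s2 ω := (sq_nonneg σ).trans hωC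
    -- As `0 ≤ L ≤ 1/2 + 2 t l`, `44 L ≤ 48 L ≤ 24 + 96 t l`.
    have h1 : s2 ω * (44 * L) ≤ s2 ω * (24 + 96 * t * l) :=
      mul_le_mul_of_nonneg_left (by linarith) hs0
    have h2 : 0 ≤ σ ^ 2 * x := by positivity
    have h3 : ‖m ω - μ‖ ^ 2 ≤ ‖LassoAgg.predict X (b ω lam) - μ‖ ^ 2
        + s2 ω * (24 + 96 * t * l) + 22 * σ ^ 2 * x := by linarith
    have h4 := mul_le_mul_of_nonneg_left h3 (show 0 ≤ 1 / (n : ℝ) by positivity)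
    refine h4.trans (le_of_eq ?_)
    rw [LassoAgg.empSq]
    ring
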